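/- The ball-recycling game with $m\ge 1$ balls, $n\ge 1$ bins and a probability distribution $\mathbf p$ on the bins is played as follows. A state is a configuration $X=(X_1,\dots,X_n)$ of the balls, $\sum_i X_i=m$, together with an internal state of the strategy. In each round a recycling strategy, given the configuration and its internal state, picks (possibly at random) a non-empty bin $\ell$; the $X_\ell$ balls of that bin are taken out and thrown again into the $n$ bins independently according to $\mathbf p$, and the strategy then updates its internal state (possibly at random, and possibly keeping the whole history). Let $R_t$ be the number of balls recycled in round $t$. A strategy has recycling rate $r$ if, from every initial distribution, $\lim_{T\to\infty}\frac1T\sum_{t=1}^{T}\mathbb E[R_t]=r$, the game has a stationary distribution, and in every stationary distribution the expected number of balls recycled per round is $r$. Fullest Bin is any stateless strategy that always picks a bin with the largest number of balls (ties broken by any rule, possibly random, depending only on the configuration). Golden Gate remembers the bin $b$ picked last and picks the first non-empty bin among $b+1,b+2,\dots,b+n$ (indices modulo $n$). **Theorem.** Let $\mathbf p$ be the uniform distribution on the $n$ bins. There is an absolute constant $C$ such that for all $n\ge1$ and $m\ge1$: 1. Fullest Bin (for each tie-breaking rule) and Golden Gate each have a recycling rate, and it is at least $\frac{2m}{n+1}$.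 2. For every recycling strategy and every initial distribution, $$\limsup_{T\to\infty}\frac1T\sum_{t=1}^{T}\mathbb E[R_t]\;\le\;\frac{2m+n-1}{n}\;<\;\frac{2m}{n}+1,$$ and in every stationary distribution of any recycling strategy the expected number of balls recycled per round is at most $\frac{2m+n-1}{n}$. 3. Fullest Bin and Golden Gate are optimal up to the additive constant $C$: if $r$ is the recycling rate of either of them, then for every recycling strategy and every initial distribution $\limsup_{T\to\infty}\frac1T\sum_{t=1}^{T}\mathbb E[R_t]\le r+C$. -/

import Mathlib

open scoped Topology

universe u

noncomputable section

namespace BallRecycling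

/-- A configuration of `m` indistinguishable balls in `n` bins: the number of balls in each bin. -/
abbrev Config (n m : ℕ) : Type := {X : Fin n → ℕ // ∑ i, X i = m}

/-- The number of balls in bin `i`. -/
def Config.load {n m : ℕ} (X : Config n m) (i : Fin n) : ℕ := X.1 i

theorem Config.exists_load_ne_zero {n m : ℕ} [NeZero m] (X : Config n m) :
    ∃ i, X.load i ≠ 0 := by
  by_contra! h
  exact NeZero.ne m (X.2.symm.trans (Finset.sum_eq_zero fun i _ => h i))

/-- Add one ball to bin `i`. -/
def Config.addBall {n k : ℕ} (Y : Config n k) (i : Fin n) : Config n (k + 1) :=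
  ⟨Y.1 + Pi.single i 1, by simp [Finset.sum_add_distrib, Y.2]⟩

/-- Empty bin `i` of `X`, and put its balls back as prescribed by `Y`. -/
def Config.refill {n m : ℕ} (X : Config n m) (i : Fin n) (Y : Config n (X.load i)) :
    Config n m :=
  ⟨Function.update X.1 i 0 + Y.1, by
    have h1 : ∑ j, Function.update X.1 i 0 j + X.1 i = m := by
      have h := Finset.sum_update_of_mem (Finset.mem_univ i) X.1 0
      have h' := Finset.sum_sdiff (f := X.1) (Finset.subset_univ {i})
      rw [Finset.sum_singleton] at h'
      have h3 := X.2
      omega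
    have h2 : ∑ j, Y.1 j = X.1 i := Y.2
    simp only [Pi.add_apply, Finset.sum_add_distrib]
    omega⟩

/-- The law of the configuration obtained by throwing `k` balls into `n` empty bins,
independently, each according to `p`. -/
def throwBalls {n : ℕ} (p : PMF (Fin n)) : (k : ℕ) → PMF (Config n k)
  | 0 => PMF.pure ⟨0, by simp⟩
  | k + 1 => (throwBalls p k).bind fun Y => p.map fun i => Y.addBall i

/-- The law of the configuration obtained from `X` by recycling bin `i`: its balls are taken out
and thrown again, independently, each according to `p`. -/
def recycle {n m : ℕ} (p : PMF (Fin n)) (X : Config n m) (i : Fin n) : PMF (Config n m) :=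
  (throwBalls p (X.load i)).map (X.refill i)

/-- A recycling strategy with internal states in `σ`. Given the configuration and the internal
state, it selects, possibly at random, a non-empty bin; once that bin has been recycled, it
updates its internal state, possibly at random, knowing the old internal state, the old
configuration, the bin that was picked and the new configuration. Since `σ` is arbitrary (it may
hold the time and the whole history), this covers every randomized history-dependent policy. -/
structure Strategy (n m : ℕ) (σ : Type*) where
  /-- the law of the selected bin -/
  select : Config n m → σ → PMF (Fin n)
  /-- the selected bin is never empty -/
  select_nonempty : ∀ X s, ∀ i ∈ (select X s).support, X.load i ≠ 0
  /-- the law of the next internal state -/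
  update : σ → Config n m → Fin n → Config n m → PMF σ

namespace Strategy

variable {n m : ℕ} {σ : Type*}

/-- One round of the game, as a Markov transition on pairs (configuration, internal state). -/
def step (A : Strategy n m σ) (p : PMF (Fin n)) (z : Config n m × σ) : PMF (Config n m × σ) :=
  (A.select z.1 z.2).bind fun i =>
    (recycle p z.1 i).bind fun Y =>
      (A.update z.2 z.1 i Y).map fun s => (Y, s)

/-- The law of the pair (configuration, internal state) after `t` rounds, for a start with
law `μ₀`. -/
def law (A : Strategy n m σ) (p : PMF (Fin n)) (μ₀ : PMF (Config n m × σ)) :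
    ℕ → PMF (Config n m × σ)
  | 0 => μ₀
  | t + 1 => (A.law p μ₀ t).bind (A.step p)

/-- The expected number of balls that are recycled in the next round from the state `z`. -/
def reward (A : Strategy n m σ) (z : Config n m × σ) : ℝ :=
  ∑ i, (A.select z.1 z.2 i).toReal * (z.1.load i : ℝ)

/-- The expected number of balls that are recycled in the next round when the pair
(configuration, internal state) has law `μ`. The series converges, as `reward` takes values
in `[0, m]`. -/
def expectedReward (A : Strategy n m σ) (μ : PMF (Config n m × σ)) : ℝ :=
  ∑' z, (μ z).toReal * A.reward z

/-- The expected average number of balls recycled per round during the first `T` rounds. -/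
def averageReward (A : Strategy n m σ) (p : PMF (Fin n)) (μ₀ : PMF (Config n m × σ))
    (T : ℕ) : ℝ :=
  (∑ t ∈ Finset.range T, A.expectedReward (A.law p μ₀ t)) / T

/-- The upper limit of the expected average number of balls recycled per round; it is defined for
every strategy and every start, and it is the long-run recycling rate when the limit exists. -/
def upperRate (A : Strategy n m σ) (p : PMF (Fin n)) (μ₀ : PMF (Config n m × σ)) : ℝ :=
  Filter.limsup (A.averageReward p μ₀) Filter.atTop

/-- `π` is a stationary distribution of the game played with the strategy `A`. -/
def IsStationary (A : Strategy n m σ) (p : PMF (Fin n)) (π : PMF (Config n m × σ)) : Prop :=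
  π.bind (A.step p) = π

/-- The strategy `A` has the well-defined recycling rate `r`: from every start, the expected
average number of balls recycled per round converges to `r`; there is a stationary distribution;
and in each stationary distribution the expected number of balls recycled per round is `r`. -/
def HasRecyclingRate (A : Strategy n m σ) (p : PMF (Fin n)) (r : ℝ) : Prop :=
  (∀ μ₀, Filter.Tendsto (A.averageReward p μ₀) Filter.atTop (𝓝 r)) ∧
  (∃ π, A.IsStationary p π) ∧
  (∀ π, A.IsStationary p π → A.expectedReward π = r)

/-- The stateless strategy `A` is a version of Fullest Bin: it always picks a bin with the largest
number of balls. Ties may be broken by any rule based on the configuration, also at random. -/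
def IsFullestBin (A : Strategy n m Unit) : Prop :=
  ∀ X, ∀ i ∈ (A.select X ()).support, ∀ j, X.load j ≤ X.load i

end Strategy

theorem Config.exists_next {n m : ℕ} [NeZero n] [NeZero m] (X : Config n m) (b : Fin n) :
    ∃ k : ℕ, X.load (b + Fin.ofNat n (k + 1)) ≠ 0 := by
  obtain ⟨j, hj⟩ := X.exists_load_ne_zero
  refine ⟨(j - (b + Fin.ofNat n 1)).val, ?_⟩
  have h : b + Fin.ofNat n ((j - (b + Fin.ofNat n 1)).val + 1) = j := by
    have h1 : Fin.ofNat n ((j - (b + Fin.ofNat n 1)).val + 1)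
        = (j - (b + Fin.ofNat n 1)) + Fin.ofNat n 1 := by
      ext; simp [Fin.val_add]
    rw [h1, add_comm (j - _), ← add_assoc, add_sub_cancel]
  rwa [h]

open Classical in
/-- The first non-empty bin among `b + 1, b + 2, …, b + n` (indices modulo `n`). -/
def Config.next {n m : ℕ} [NeZero n] [NeZero m] (X : Config n m) (b : Fin n) : Fin n :=
  b + Fin.ofNat n (Nat.find (X.exists_next b) + 1)

/-- Golden Gate: the bins are picked in round-robin fashion, empty bins being skipped. The internal
state is the bin that was picked last. -/
def goldenGate (n m : ℕ) [NeZero n] [NeZero m] : Strategy n m (Fin n) where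
  select X b := PMF.pure (X.next b)
  select_nonempty X b i hi := by
    classical
    rw [PMF.support_pure, Set.mem_singleton_iff] at hi
    rw [hi]
    exact Nat.find_spec (X.exists_next b)
  update _ _ i _ := PMF.pure i

/-- Fullest Bin exists: it suffices to pick one fullest bin in each configuration. -/
theorem exists_isFullestBin (n m : ℕ) [NeZero n] [NeZero m] :
    ∃ A : Strategy n m Unit, A.IsFullestBin := by
  have h : ∀ X : Config n m, ∃ i, ∀ j, X.load j ≤ X.load i := fun X =>
    Finite.exists_max X.load
  choose c hc using h
  refine ⟨⟨fun X _ => PMF.pure (c X), ?_, fun s _ _ _ => PMF.pure s⟩, ?_⟩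
  · intro X s i hi h0
    rw [PMF.support_pure, Set.mem_singleton_iff] at hi
    obtain ⟨j, hj⟩ := X.exists_load_ne_zero
    have := hc X j
    subst hi
    omega
  · intro X i hi
    simp only [PMF.support_pure, Set.mem_singleton_iff] at hi
    rw [hi]
    exact hc X

end BallRecycling

end

noncomputable section

namespace BallRecycling

/-! ### Expectations of bounded functions under a `PMF` -/

/-! Each bound is a drift argument: a bounded potential whose expected one-round change is
controlled by the number `k` of recycled balls. Such changes cancel in stationarity and contribute
only `O(1/T)` to averages over `T` rounds.

Upper bound: for `∑ X_j²` the drift is `(k(2m+n-1) - (n+1)k²)/n` (`expect_recycle_sum_sq`). Balance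
and `E[k²] ≥ E[k]²` force `E[k] ≤ (2m+n-1)/(n+1)`, whatever the strategy; `quadratic_drift` is this
with the square completed.

Lower bounds: for Fullest Bin, the potential `∑ min(X_a, X_b)` has drift at most `(n+1)k - 2m`. For
Golden Gate, weigh every ball by its clockwise distance from the last picked bin: each of the `m-k`
untouched balls comes closer by at least one, while a rethrown ball lands at mean distance
`(n-1)/2`. Both give `E[k] ≥ 2m/(n+1)`, less than 1 below the upper bound.

The rates exist because both games are finite chains in which one state, all balls in bin 0, is
reachable from everywhere. The Poisson equation is then solvable (`exists_poisson`), and it fixes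
the long-run average and the mean under every stationary law. -/

/-- The expectation of the real function `f` under `μ`. -/
def expect {α : Type*} (μ : PMF α) (f : α → ℝ) : ℝ := ∑' a, (μ a).toReal * f a

/-- The real function `f` is bounded. -/
def IsBdd {α : Type*} (f : α → ℝ) : Prop := ∃ B, ∀ a, |f a| ≤ B

section Expect

variable {α β : Type*}

theorem IsBdd.of_finite [Finite α] (f : α → ℝ) : IsBdd f := by
  cases nonempty_fintype α
  exact ⟨∑ a, |f a|, fun a =>
    Finset.single_le_sum (f := fun a => |f a|) (fun _ _ => abs_nonneg _) (Finset.mem_univ a)⟩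

theorem IsBdd.comp {f : β → ℝ} (hf : IsBdd f) (φ : α → β) : IsBdd fun a => f (φ a) :=
  hf.imp fun _ h a => h (φ a)

theorem summable_toReal (μ : PMF α) : Summable fun a => (μ a).toReal :=
  ENNReal.summable_toReal (by rw [μ.tsum_coe]; exact ENNReal.one_ne_top)

theorem tsum_toReal (μ : PMF α) : ∑' a, (μ a).toReal = 1 := by
  rw [← ENNReal.tsum_toReal_eq fun a => μ.apply_ne_top a, μ.tsum_coe, ENNReal.toReal_one]

theorem IsBdd.summable {f : α → ℝ} (hf : IsBdd f) (μ : PMF α) :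
    Summable fun a => (μ a).toReal * f a := by
  obtain ⟨B, hB⟩ := hf
  refine Summable.of_norm_bounded ((summable_toReal μ).mul_right B) fun a => ?_
  rw [Real.norm_eq_abs, abs_mul, abs_of_nonneg ENNReal.toReal_nonneg]
  exact mul_le_mul_of_nonneg_left (hB a) ENNReal.toReal_nonneg

theorem expect_const (μ : PMF α) (c : ℝ) : expect μ (fun _ => c) = c := by
  rw [expect, tsum_mul_right, tsum_toReal, one_mul]

theorem expect_mul_left (μ : PMF α) (c : ℝ) (f : α → ℝ) :
    expect μ (fun a => c * f a) = c * expect μ f := by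
  simp only [expect, ← tsum_mul_left]
  exact tsum_congr fun a => by ring

theorem expect_add (μ : PMF α) {f g : α → ℝ} (hf : IsBdd f) (hg : IsBdd g) :
    expect μ (fun a => f a + g a) = expect μ f + expect μ g := by
  simp only [expect, mul_add]
  exact (hf.summable μ).tsum_add (hg.summable μ)

theorem expect_mono_of_support (μ : PMF α) {f g : α → ℝ} (hf : IsBdd f) (hg : IsBdd g)
    (h : ∀ a ∈ μ.support, f a ≤ g a) : expect μ f ≤ expect μ g := by
  refine (hf.summable μ).tsum_le_tsum (fun a => ?_) (hg.summable μ)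
  by_cases ha : a ∈ μ.support
  · exact mul_le_mul_of_nonneg_left (h a ha) ENNReal.toReal_nonneg
  · rw [(μ.apply_eq_zero_iff a).2 ha]; simp

theorem expect_mono (μ : PMF α) {f g : α → ℝ} (hf : IsBdd f) (hg : IsBdd g)
    (h : ∀ a, f a ≤ g a) : expect μ f ≤ expect μ g :=
  expect_mono_of_support μ hf hg fun a _ => h a

theorem abs_expect_le (μ : PMF α) {f : α → ℝ} {B : ℝ} (h : ∀ a, |f a| ≤ B) :
    |expect μ f| ≤ B := by
  have hB : IsBdd fun _ : α => B := ⟨|B|, fun _ => le_rfl⟩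
  have hB' : IsBdd fun _ : α => -B := ⟨|-B|, fun _ => le_rfl⟩
  rw [abs_le]
  constructor
  · rw [← expect_const μ (-B)]
    exact expect_mono μ hB' ⟨B, h⟩ fun a => (abs_le.1 (h a)).1
  · rw [← expect_const μ B]
    exact expect_mono μ ⟨B, h⟩ hB fun a => (abs_le.1 (h a)).2

theorem IsBdd.expect {f : β → ℝ} (hf : IsBdd f) (k : α → PMF β) :
    IsBdd fun a => expect (k a) f :=
  hf.imp fun _ h a => abs_expect_le (k a) h

theorem IsBdd.add {f g : α → ℝ} (hf : IsBdd f) (hg : IsBdd g) : IsBdd fun a => f a + g a := by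
  obtain ⟨B, hB⟩ := hf
  obtain ⟨C, hC⟩ := hg
  exact ⟨B + C, fun a => (abs_add_le _ _).trans (add_le_add (hB a) (hC a))⟩

theorem IsBdd.const (c : ℝ) : IsBdd fun _ : α => c := ⟨|c|, fun _ => le_rfl⟩

theorem IsBdd.const_mul {f : α → ℝ} (hf : IsBdd f) (c : ℝ) : IsBdd fun a => c * f a := by
  obtain ⟨B, hB⟩ := hf
  exact ⟨|c| * B, fun a => by
    rw [abs_mul]; exact mul_le_mul_of_nonneg_left (hB a) (abs_nonneg c)⟩

theorem expect_pure (a : α) (f : α → ℝ) : expect (PMF.pure a) f = f a := by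
  rw [expect, tsum_eq_single a]
  · simp
  · intro b hb
    simp [PMF.pure_apply, hb]

/-- Fubini; boundedness of `f` makes the double series absolutely summable, which matters because
internal state spaces are arbitrary. -/
theorem expect_bind (μ : PMF α) (k : α → PMF β) {f : β → ℝ} (hf : IsBdd f) :
    expect (μ.bind k) f = expect μ fun a => expect (k a) f := by
  obtain ⟨B, hB⟩ := hf
  have hne : ∀ a b, μ a * k a b ≠ ⊤ := fun a b =>
    ENNReal.mul_ne_top (μ.apply_ne_top a) ((k a).apply_ne_top b)
  have hsum : Summable fun x : α × β => (μ x.1 * k x.1 x.2).toReal := by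
    refine ENNReal.summable_toReal ?_
    rw [ENNReal.tsum_prod (f := fun a b => μ a * k a b)]
    simp [ENNReal.tsum_mul_left, PMF.tsum_coe]
  have hsum' : Summable fun x : α × β => (μ x.1 * k x.1 x.2).toReal * f x.2 := by
    refine Summable.of_norm_bounded (hsum.mul_right B) fun x => ?_
    rw [Real.norm_eq_abs, abs_mul, abs_of_nonneg ENNReal.toReal_nonneg]
    exact mul_le_mul_of_nonneg_left (hB x.2) ENNReal.toReal_nonneg
  calc expect (μ.bind k) f
      = ∑' b, ∑' a, (μ a * k a b).toReal * f b := by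
        refine tsum_congr fun b => ?_
        rw [PMF.bind_apply, ENNReal.tsum_toReal_eq fun a => hne a b, tsum_mul_right]
    _ = ∑' a, ∑' b, (μ a * k a b).toReal * f b :=
        Summable.tsum_comm (f := fun a b => (μ a * k a b).toReal * f b) hsum'
    _ = expect μ fun a => expect (k a) f := by
        refine tsum_congr fun a => ?_
        change _ = (μ a).toReal * ∑' b, (k a b).toReal * f b
        rw [← tsum_mul_left]
        exact tsum_congr fun b => by rw [ENNReal.toReal_mul, mul_assoc]

theorem expect_map (μ : PMF α) (φ : α → β) {f : β → ℝ} (hf : IsBdd f) :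
    expect (μ.map φ) f = expect μ fun a => f (φ a) := by
  rw [PMF.map, expect_bind μ _ hf]
  simp only [Function.comp_apply, expect_pure]

theorem expect_fintype [Fintype α] (μ : PMF α) (f : α → ℝ) :
    expect μ f = ∑ a, (μ a).toReal * f a := tsum_fintype _

theorem expect_finset_sum {ι : Type*} (s : Finset ι) (μ : PMF α) {f : ι → α → ℝ}
    (hf : ∀ i, IsBdd (f i)) :
    expect μ (fun a => ∑ i ∈ s, f i a) = ∑ i ∈ s, expect μ (f i) := by
  simp only [expect, Finset.mul_sum]
  exact Summable.tsum_finsetSum fun i _ => (hf i).summable μ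

theorem expect_uniform {n : ℕ} [NeZero n] (f : Fin n → ℝ) :
    expect (PMF.uniformOfFintype (Fin n)) f = (∑ i, f i) / n := by
  simp [expect_fintype, ← Finset.mul_sum, div_eq_inv_mul]

end Expect

/-! ### Drift inequalities and the Poisson equation for Markov chains -/

section Markov

variable {S : Type*}

/-- `G` is a potential: integrating the one-step inequality against `μ t` makes the sum over `t`
telescope. -/
theorem sum_expect_le_of_drift {P : S → PMF S} {μ : ℕ → PMF S}
    (hμ : ∀ t, μ (t + 1) = (μ t).bind P) {f G : S → ℝ} (hf : IsBdd f) (hG : IsBdd G) {c : ℝ}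
    (h : ∀ z, f z + expect (P z) G ≤ c + G z) (T : ℕ) :
    ∑ t ∈ Finset.range T, expect (μ t) f ≤ c * T + expect (μ 0) G - expect (μ T) G := by
  induction T with
  | zero => simp
  | succ T ih =>
    have h1 := expect_mono (μ T) (hf.add (hG.expect P)) ((IsBdd.const c).add hG) h
    rw [expect_add _ hf (hG.expect P), expect_add _ (IsBdd.const c) hG, expect_const,
      ← expect_bind _ _ hG, ← hμ] at h1
    rw [Finset.sum_range_succ]
    push_cast
    linarith

theorem average_le_of_drift {P : S → PMF S} {μ : ℕ → PMF S}
    (hμ : ∀ t, μ (t + 1) = (μ t).bind P) {f G : S → ℝ} (hf : IsBdd f) (hG : IsBdd G) {c : ℝ}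
    (h : ∀ z, f z + expect (P z) G ≤ c + G z) :
    ∃ D, ∀ T : ℕ, 0 < T → (∑ t ∈ Finset.range T, expect (μ t) f) / T ≤ c + D / T := by
  obtain ⟨B, hB⟩ := id hG
  refine ⟨2 * B, fun T hT => ?_⟩
  have hT' : (0 : ℝ) < T := Nat.cast_pos.2 hT
  have h1 := sum_expect_le_of_drift hμ hf hG h T
  have h2 := (abs_le.1 (abs_expect_le (μ 0) hB)).2
  have h3 := (abs_le.1 (abs_expect_le (μ T) hB)).1
  rw [div_le_iff₀ hT', add_mul, div_mul_cancel₀ _ hT'.ne']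
  linarith

theorem expect_le_of_drift_of_stationary {P : S → PMF S} {π : PMF S} (hπ : π.bind P = π)
    {f G : S → ℝ} (hf : IsBdd f) (hG : IsBdd G) {c : ℝ}
    (h : ∀ z, f z + expect (P z) G ≤ c + G z) : expect π f ≤ c := by
  -- For a constant sequence of laws the two boundary terms cancel, so one round suffices.
  have h1 := sum_expect_le_of_drift (μ := fun _ => π) (fun _ => hπ.symm) hf hG h 1
  simpa using h1

theorem expect_neg {α : Type*} (μ : PMF α) (f : α → ℝ) :
    expect μ (fun a => -f a) = -expect μ f := by
  simpa using expect_mul_left μ (-1) f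

theorem IsBdd.neg {α : Type*} {f : α → ℝ} (hf : IsBdd f) : IsBdd fun a => -f a := by
  simpa using hf.const_mul (-1)

theorem le_expect_of_drift_of_stationary {P : S → PMF S} {π : PMF S} (hπ : π.bind P = π)
    {f G : S → ℝ} (hf : IsBdd f) (hG : IsBdd G) {c : ℝ}
    (h : ∀ z, c + G z ≤ f z + expect (P z) G) : c ≤ expect π f := by
  have h1 := expect_le_of_drift_of_stationary hπ (f := fun z => -f z) (G := fun z => -(G z))
    (c := -c) hf.neg hG.neg fun z => ?_
  · rw [expect_neg] at h1
    linarith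
  · rw [expect_neg]
    linarith [h z]

theorem tendsto_const_add_div (c D : ℝ) :
    Filter.Tendsto (fun T : ℕ => c + D / T) Filter.atTop (𝓝 c) := by
  simpa using (tendsto_const_div_atTop_nhds_zero_nat D).const_add c

/-- The equation is a drift inequality for both `f` and `-f`, which squeezes the averages. -/
theorem tendsto_average_of_poisson {P : S → PMF S} {μ : ℕ → PMF S}
    (hμ : ∀ t, μ (t + 1) = (μ t).bind P) {f g : S → ℝ} (hf : IsBdd f) (hg : IsBdd g) {r : ℝ}
    (h : ∀ z, f z + expect (P z) g = r + g z) :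
    Filter.Tendsto (fun T : ℕ => (∑ t ∈ Finset.range T, expect (μ t) f) / T) Filter.atTop
      (𝓝 r) := by
  obtain ⟨D, hD⟩ := average_le_of_drift hμ hf hg fun z => (h z).le
  obtain ⟨D', hD'⟩ := average_le_of_drift hμ (f := fun z => -f z) (G := fun z => -g z) (c := -r)
    hf.neg hg.neg fun z => by rw [expect_neg]; linarith [h z]
  refine tendsto_of_tendsto_of_tendsto_of_le_of_le' (tendsto_const_add_div r (-D'))
    (tendsto_const_add_div r D) ?_ ?_
  · filter_upwards [Filter.eventually_gt_atTop 0] with T hT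
    have := hD' T hT
    simp only [expect_neg, Finset.sum_neg_distrib, neg_div] at this ⊢
    linarith
  · filter_upwards [Filter.eventually_gt_atTop 0] with T hT using hD T hT

variable [Fintype S]

/-- Maximum principle: at a maximum of a harmonic function all possible successors are maxima too,
and this propagates to `z₀`. -/
theorem le_of_harmonic {P : S → PMF S} {z₀ : S}
    (hz : ∀ z, Relation.ReflTransGen (fun a b => b ∈ (P a).support) z z₀)
    {g : S → ℝ} (hg : ∀ z, expect (P z) g = g z) (x : S) : g x ≤ g z₀ := by
  have : Nonempty S := ⟨z₀⟩
  obtain ⟨z, hmax⟩ := Finite.exists_max g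
  have key : ∀ y, Relation.ReflTransGen (fun a b => b ∈ (P a).support) z y → g y = g z := by
    intro y hy
    induction hy with
    | refl => rfl
    | @tail b c _ hbc ih =>
      have h0 : ∑ w, (P b w).toReal * (g z - g w) = 0 := by
        have h1 := hg b
        have h2 := expect_const (P b) (g z)
        rw [expect_fintype] at h1 h2
        simp only [mul_sub, Finset.sum_sub_distrib, h1, h2, ih, sub_self]
      have h1 := (Finset.sum_eq_zero_iff_of_nonneg fun w _ =>
        mul_nonneg ENNReal.toReal_nonneg (sub_nonneg.2 (hmax w))).1 h0 c (Finset.mem_univ c)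
      have h2 : (P b c).toReal ≠ 0 :=
        ENNReal.toReal_ne_zero.2 ⟨((P b).mem_support_iff c).1 hbc, (P b).apply_ne_top c⟩
      have := (mul_eq_zero.1 h1).resolve_left h2
      linarith
  rw [key z₀ (hz z)]
  exact hmax x

/-- If some state can be reached from all states of a finite Markov chain, then the Poisson
equation is solvable. -/
theorem exists_poisson {P : S → PMF S} {z₀ : S}
    (hz : ∀ z, Relation.ReflTransGen (fun a b => b ∈ (P a).support) z z₀) (f : S → ℝ) :
    ∃ (r : ℝ) (g : S → ℝ), ∀ z, f z + expect (P z) g = r + g z := by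
  have : Nonempty S := ⟨z₀⟩
  -- The kernel of `g ↦ g - Pg` consists of the constants. The extra term `g z₀` makes the map
  -- injective, hence surjective in finite dimension, and `g z₀` then serves as `r`.
  let Ψ : (S → ℝ) →ₗ[ℝ] (S → ℝ) :=
    { toFun := fun g z => g z - expect (P z) g + g z₀
      map_add' := fun g h => by
        ext z
        have := expect_add (P z) (IsBdd.of_finite g) (IsBdd.of_finite h)
        simp only [Pi.add_apply]
        rw [show expect (P z) (g + h) = expect (P z) g + expect (P z) h from this]
        ring
      map_smul' := fun c g => by
        ext z
        have := expect_mul_left (P z) c g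
        simp only [Pi.smul_apply, smul_eq_mul, RingHom.id_apply]
        rw [show expect (P z) (c • g) = c * expect (P z) g from this]
        ring }
  have hΨ : ∀ g z, Ψ g z = g z - expect (P z) g + g z₀ := fun _ _ => rfl
  have hinj : Function.Injective Ψ := by
    rw [injective_iff_map_eq_zero]
    intro g hg
    have h0 : ∀ z, g z - expect (P z) g + g z₀ = 0 := fun z => by rw [← hΨ, hg]; rfl
    have hc : g z₀ = 0 := by
      obtain ⟨a, ha⟩ := Finite.exists_max g
      obtain ⟨b, hb⟩ := Finite.exists_min g
      have h1 := expect_mono (P a) (IsBdd.of_finite g) (IsBdd.const (g a)) ha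
      have h2 := expect_mono (P b) (IsBdd.const (g b)) (IsBdd.of_finite g) hb
      rw [expect_const] at h1 h2
      linarith [h0 a, h0 b]
    have hh : ∀ z, expect (P z) g = g z := fun z => by linarith [h0 z]
    ext x
    have h1 := le_of_harmonic hz hh x
    have h2 := le_of_harmonic hz (g := fun z => -g z)
      (fun z => by rw [expect_neg, hh]) x
    simp only [Pi.zero_apply]
    linarith
  obtain ⟨g, hg⟩ := LinearMap.injective_iff_surjective.1 hinj f
  exact ⟨g z₀, g, fun z => by rw [← hg, hΨ]; ring⟩

/-- The stationary law is the limit of the mean occupation frequencies, which converge by the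
Poisson equation for the indicators. -/
theorem exists_stationary {P : S → PMF S} {z₀ : S}
    (hz : ∀ z, Relation.ReflTransGen (fun a b => b ∈ (P a).support) z z₀) {μ : ℕ → PMF S}
    (hμ : ∀ t, μ (t + 1) = (μ t).bind P) : ∃ π : PMF S, π.bind P = π := by
  classical
  let a : (S → ℝ) → ℕ → ℝ := fun f T => (∑ t ∈ Finset.range T, expect (μ t) f) / T
  have hlim : ∀ f, ∃ r, Filter.Tendsto (a f) Filter.atTop (𝓝 r) := fun f => by
    obtain ⟨r, g, h⟩ := exists_poisson hz f
    exact ⟨r, tendsto_average_of_poisson hμ (IsBdd.of_finite f) (IsBdd.of_finite g) h⟩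
  have hcomb : ∀ (c : S → ℝ), Filter.Tendsto (a c) Filter.atTop
      (𝓝 (∑ z, c z * (hlim (Pi.single z 1)).choose)) := fun c => by
    have h1 : a c = fun T => ∑ z, c z * a (Pi.single z 1) T := by
      ext T
      have h2 : ∀ t, expect (μ t) c = ∑ z, c z * expect (μ t) (Pi.single z 1) := fun t => by
        simp [expect_fintype, Pi.single_apply, mul_comm]
      simp only [a, h2, mul_div_assoc']
      rw [Finset.sum_comm, Finset.sum_div]
      simp only [Finset.mul_sum]
    rw [h1]
    exact tendsto_finsetSum _ fun z _ => (hlim _).choose_spec.const_mul _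
  set ρ : S → ℝ := fun z => (hlim (Pi.single z 1)).choose with hρ
  have hρ0 : ∀ z, 0 ≤ ρ z := fun z => by
    refine ge_of_tendsto' (hlim (Pi.single z 1)).choose_spec fun T => ?_
    refine div_nonneg (Finset.sum_nonneg fun t _ => ?_) (Nat.cast_nonneg T)
    rw [expect_fintype]
    refine Finset.sum_nonneg fun w _ => mul_nonneg ENNReal.toReal_nonneg ?_
    rw [Pi.single_apply]
    split_ifs <;> norm_num
  have hρ1 : ∑ z, ρ z = 1 := by
    have h1 := hcomb fun _ => 1
    simp only [one_mul] at h1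
    refine tendsto_nhds_unique h1 (tendsto_const_nhds.congr' ?_)
    filter_upwards [Filter.eventually_gt_atTop 0] with T hT
    have : (T : ℝ) ≠ 0 := (Nat.cast_pos.2 hT).ne'
    simp [a, expect_const, this]
  have hinv : ∀ w, ∑ z, (P z w).toReal * ρ z = ρ w := fun w => by
    have hP : ∀ z, expect (P z) (Pi.single w 1) = (P z w).toReal := fun z => by
      simp [expect_fintype, Pi.single_apply]
    have h1 := (hlim (Pi.single w 1)).choose_spec
    have h2 := hcomb fun z => (P z w).toReal
    -- The indicator of `w` itself solves the Poisson equation for this function, with `r = 0`.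
    have h3 : Filter.Tendsto (a fun z => (Pi.single w 1 : S → ℝ) z + -(P z w).toReal)
        Filter.atTop (𝓝 0) := by
      refine tendsto_average_of_poisson hμ (IsBdd.of_finite _)
        (IsBdd.of_finite (Pi.single w 1)) fun z => ?_
      rw [hP]; ring
    have h4 : (a fun z => (Pi.single w 1 : S → ℝ) z + -(P z w).toReal)
        = fun T => a (Pi.single w 1) T - a (fun z => (P z w).toReal) T := by
      ext T
      simp only [a]
      rw [← sub_div, ← Finset.sum_sub_distrib]
      congr 1
      refine Finset.sum_congr rfl fun t _ => ?_
      rw [expect_add _ (IsBdd.of_finite _) (IsBdd.of_finite _), expect_neg, sub_eq_add_neg]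
    rw [h4] at h3
    have := tendsto_nhds_unique h3 (h1.sub h2)
    linarith
  refine ⟨PMF.ofFintype (fun z => ENNReal.ofReal (ρ z)) ?_, ?_⟩
  · rw [← ENNReal.ofReal_sum_of_nonneg fun z _ => hρ0 z, hρ1, ENNReal.ofReal_one]
  · ext w
    rw [PMF.bind_apply, tsum_fintype, PMF.ofFintype_apply, ← hinv w,
      ENNReal.ofReal_sum_of_nonneg fun z _ => mul_nonneg ENNReal.toReal_nonneg (hρ0 z)]
    refine Finset.sum_congr rfl fun z _ => ?_
    rw [PMF.ofFintype_apply, ENNReal.ofReal_mul ENNReal.toReal_nonneg,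
      ENNReal.ofReal_toReal ((P z).apply_ne_top w), mul_comm]

end Markov

/-! ### Throwing balls -/

section Throw

variable {n m : ℕ}

instance : Finite (Config n m) := by
  refine Finite.of_injective
    (fun (X : Config n m) (i : Fin n) => (⟨X.1 i, Nat.lt_succ_of_le ?_⟩ : Fin (m + 1))) ?_
  · exact (Finset.single_le_sum (fun _ _ => Nat.zero_le _) (Finset.mem_univ i)).trans_eq X.2
  · intro X Y h
    ext i
    simpa using congrArg Fin.val (congrFun h i)

theorem Config.sum_load (X : Config n m) : ∑ i, (X.load i : ℝ) = m := by
  rw [← Nat.cast_sum]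
  exact congrArg Nat.cast X.2

theorem Config.load_le (X : Config n m) (i : Fin n) : X.load i ≤ m :=
  (Finset.single_le_sum (fun _ _ => Nat.zero_le _) (Finset.mem_univ i)).trans_eq X.2

theorem Config.addBall_load {k : ℕ} (Y : Config n k) (i j : Fin n) :
    ((Y.addBall i).load j : ℝ) = Y.load j + if j = i then 1 else 0 := by
  simp [Config.load, Config.addBall, Pi.single_apply]

theorem expect_throwBalls_succ [NeZero n] (k : ℕ) (f : Config n (k + 1) → ℝ) :
    expect (throwBalls (PMF.uniformOfFintype (Fin n)) (k + 1)) f =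
      expect (throwBalls (PMF.uniformOfFintype (Fin n)) k)
        fun Y => (∑ i, f (Y.addBall i)) / n := by
  rw [throwBalls, expect_bind _ _ (IsBdd.of_finite f)]
  simp only [expect_map _ _ (IsBdd.of_finite f), expect_uniform]

theorem expect_throwBalls_load [NeZero n] (k : ℕ) (j : Fin n) :
    expect (throwBalls (PMF.uniformOfFintype (Fin n)) k) (fun Y => (Y.load j : ℝ)) = k / n := by
  induction k with
  | zero => simp [throwBalls, expect_pure, Config.load]
  | succ k ih =>
    have hn : (n : ℝ) ≠ 0 := NeZero.ne _
    rw [expect_throwBalls_succ]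
    have h : ∀ Y : Config n k, (∑ i, ((Y.addBall i).load j : ℝ)) / n = Y.load j + 1 / n := by
      intro Y
      simp only [Config.addBall_load, Finset.sum_add_distrib]
      simp
      field_simp
    simp only [h]
    rw [expect_add _ (IsBdd.of_finite _) (IsBdd.const _), ih, expect_const]
    push_cast
    ring

theorem expect_throwBalls_sum_sq [NeZero n] (k : ℕ) :
    expect (throwBalls (PMF.uniformOfFintype (Fin n)) k) (fun Y => ∑ j, (Y.load j : ℝ) ^ 2) =
      k + k * (k - 1) / n := by
  induction k with
  | zero => simp [throwBalls, expect_pure, Config.load]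
  | succ k ih =>
    have hn : (n : ℝ) ≠ 0 := NeZero.ne _
    rw [expect_throwBalls_succ]
    -- A new ball in bin `i` adds `2 Y_i + 1`, whose mean over `i` is `2k/n + 1`.
    have h : ∀ Y : Config n k, (∑ i, ∑ j, ((Y.addBall i).load j : ℝ) ^ 2) / n =
        (∑ j, (Y.load j : ℝ) ^ 2) + (2 * k / n + 1) := by
      intro Y
      have h1 : ∀ i j, ((Y.addBall i).load j : ℝ) ^ 2 =
          (Y.load j : ℝ) ^ 2 + if j = i then 2 * (Y.load j : ℝ) + 1 else 0 := by
        intro i j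
        rw [Config.addBall_load]
        split_ifs <;> ring
      simp only [h1, Finset.sum_add_distrib]
      simp [Finset.sum_add_distrib, ← Finset.mul_sum, Y.sum_load]
      field_simp
    simp only [h]
    rw [expect_add _ (IsBdd.of_finite _) (IsBdd.const _), ih, expect_const]
    push_cast
    field_simp
    ring

/-- The number of balls in bin `j` once bin `i` of `X` has been emptied. -/
def Config.remaining (X : Config n m) (i j : Fin n) : ℝ := if j = i then 0 else X.load j

theorem Config.refill_load (X : Config n m) (i j : Fin n) (Y : Config n (X.load i)) :
    ((X.refill i Y).load j : ℝ) = X.remaining i j + Y.load j := by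
  simp only [Config.load, Config.refill, Config.remaining, Pi.add_apply, Function.update_apply]
  push_cast
  split_ifs <;> simp

theorem Config.remaining_eq_sub (X : Config n m) (i j : Fin n) :
    X.remaining i j = X.load j - if j = i then (X.load j : ℝ) else 0 := by
  rw [Config.remaining]
  split_ifs <;> simp

theorem Config.sum_remaining (X : Config n m) (i : Fin n) :
    ∑ j, X.remaining i j = m - X.load i := by
  simp [Config.remaining_eq_sub, Finset.sum_sub_distrib, X.sum_load]

theorem expect_recycle [NeZero n] (X : Config n m) (i : Fin n) (f : Config n m → ℝ) :
    expect (recycle (PMF.uniformOfFintype (Fin n)) X i) f =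
      expect (throwBalls (PMF.uniformOfFintype (Fin n)) (X.load i)) fun Y => f (X.refill i Y) := by
  rw [recycle, expect_map _ _ (IsBdd.of_finite f)]

theorem expect_recycle_load [NeZero n] (X : Config n m) (i j : Fin n) :
    expect (recycle (PMF.uniformOfFintype (Fin n)) X i) (fun X' => (X'.load j : ℝ)) =
      X.remaining i j + X.load i / n := by
  rw [expect_recycle]
  simp only [Config.refill_load]
  rw [expect_add _ (IsBdd.const _) (IsBdd.of_finite _), expect_const, expect_throwBalls_load]

/-- With `k` balls rethrown, emptying costs `k²`, the cross terms bring `2(m-k)k/n`, and the thrown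
balls bring `k + k(k-1)/n`. -/
theorem expect_recycle_sum_sq [NeZero n] (X : Config n m) (i : Fin n) :
    expect (recycle (PMF.uniformOfFintype (Fin n)) X i)
        (fun X' => ∑ j, (X'.load j : ℝ) ^ 2) =
      ∑ j, (X.load j : ℝ) ^ 2 +
        (X.load i * (2 * m + n - 1) - (n + 1) * (X.load i : ℝ) ^ 2) / n := by
  have hn : (n : ℝ) ≠ 0 := NeZero.ne _
  rw [expect_recycle]
  have h : ∀ Y : Config n (X.load i), ∑ j, ((X.refill i Y).load j : ℝ) ^ 2 =
      ∑ j, (X.remaining i j) ^ 2 +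
        (∑ j, (2 * X.remaining i j) * (Y.load j : ℝ) + ∑ j, (Y.load j : ℝ) ^ 2) := by
    intro Y
    simp only [Config.refill_load, ← Finset.sum_add_distrib]
    exact Finset.sum_congr rfl fun j _ => by ring
  simp only [h]
  rw [expect_add _ (IsBdd.const _) (IsBdd.of_finite _),
    expect_add _ (IsBdd.of_finite _) (IsBdd.of_finite _), expect_const,
    expect_throwBalls_sum_sq, expect_finset_sum _ _ fun _ => IsBdd.of_finite _]
  simp only [expect_mul_left, expect_throwBalls_load, ← Finset.sum_mul, ← Finset.mul_sum,
    Config.sum_remaining]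
  have h2 : ∑ j, (X.remaining i j) ^ 2 = ∑ j, (X.load j : ℝ) ^ 2 - (X.load i : ℝ) ^ 2 := by
    have h3 : ∀ j, (X.remaining i j) ^ 2 =
        (X.load j : ℝ) ^ 2 - if j = i then (X.load j : ℝ) ^ 2 else 0 := fun j => by
      rw [Config.remaining]
      split_ifs <;> ring
    simp [h3, Finset.sum_sub_distrib]
  rw [h2]
  field_simp
  ring

/-- By concavity of `min`, its mean is at most the minimum of the mean loads. Emptying a fullest bin
with `k` balls removes `2m - k`; raising every mean by `k/n` adds `nk` over the `n²` pairs. -/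
theorem expect_recycle_sum_min_le [NeZero n] (X : Config n m) (i : Fin n)
    (hi : ∀ j, X.load j ≤ X.load i) :
    expect (recycle (PMF.uniformOfFintype (Fin n)) X i)
        (fun X' => ∑ a, ∑ b, min (X'.load a : ℝ) (X'.load b)) ≤
      ∑ a, ∑ b, min (X.load a : ℝ) (X.load b) + ((n + 1) * X.load i - 2 * m) := by
  have hn : (n : ℝ) ≠ 0 := NeZero.ne _
  rw [expect_finset_sum _ _ fun _ => IsBdd.of_finite _]
  have h1 : ∀ a b, expect (recycle (PMF.uniformOfFintype (Fin n)) X i)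
      (fun X' => min (X'.load a : ℝ) (X'.load b)) ≤
      min (X.remaining i a) (X.remaining i b) + X.load i / n := by
    intro a b
    rw [← min_add_add_right, ← expect_recycle_load, ← expect_recycle_load]
    exact le_min
      (expect_mono _ (IsBdd.of_finite _) (IsBdd.of_finite _) fun _ => min_le_left _ _)
      (expect_mono _ (IsBdd.of_finite _) (IsBdd.of_finite _) fun _ => min_le_right _ _)
  -- Since bin `i` is fullest, a minimum in row or column `i` is the other load; the last term
  -- restores the entry `(i, i)`, subtracted twice.
  have h2 : ∀ a b, min (X.remaining i a) (X.remaining i b) = min (X.load a : ℝ) (X.load b)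
      - (if a = i then (X.load b : ℝ) else 0) - (if b = i then (X.load a : ℝ) else 0)
      + (if a = i then (if b = i then (X.load i : ℝ) else 0) else 0) := by
    intro a b
    have ha : (X.load a : ℝ) ≤ X.load i := Nat.cast_le.2 (hi a)
    have hb : (X.load b : ℝ) ≤ X.load i := Nat.cast_le.2 (hi b)
    simp only [Config.remaining]
    split_ifs with h3 h4 h4
    · subst h3 h4; simp
    · subst h3; simp [hb]
    · subst h4; simp [ha]
    · simp
  calc _ = ∑ a, ∑ b, expect (recycle (PMF.uniformOfFintype (Fin n)) X i)
            (fun X' => min (X'.load a : ℝ) (X'.load b)) :=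
        Finset.sum_congr rfl fun a _ => expect_finset_sum _ _ fun _ => IsBdd.of_finite _
    _ ≤ ∑ a, ∑ b, (min (X.remaining i a) (X.remaining i b) + X.load i / n) :=
        Finset.sum_le_sum fun a _ => Finset.sum_le_sum fun b _ => h1 a b
    _ = _ := by
        have h5 : ∑ a : Fin n, ∑ b, (if a = i then (X.load b : ℝ) else 0) = m := by
          rw [Finset.sum_comm]
          simp [X.sum_load]
        have h6 : ∑ a : Fin n, ∑ b : Fin n,
            (if a = i then (if b = i then (X.load i : ℝ) else 0) else 0) = X.load i := by
          rw [Finset.sum_comm]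
          simp
        simp only [h2, Finset.sum_add_distrib, Finset.sum_sub_distrib, h5, h6]
        simp [X.sum_load]
        field_simp
        ring

end Throw

/-! ### Strategies -/

namespace Strategy

variable {n m : ℕ} {σ : Type*}

theorem reward_eq_expect (A : Strategy n m σ) (z : Config n m × σ) :
    A.reward z = expect (A.select z.1 z.2) fun i => (z.1.load i : ℝ) :=
  (expect_fintype _ _).symm

theorem isBdd_reward (A : Strategy n m σ) : IsBdd A.reward := by
  refine ⟨m, fun z => ?_⟩
  rw [reward_eq_expect]
  exact abs_expect_le _ fun i => by
    rw [Nat.abs_cast]; exact Nat.cast_le.2 (z.1.load_le i)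

/-- For observables of the configuration alone the internal update integrates out; hence the
quadratic bound is uniform over strategies. -/
theorem expect_step (A : Strategy n m σ) (p : PMF (Fin n)) (z : Config n m × σ)
    (f : Config n m → ℝ) :
    expect (A.step p z) (fun w => f w.1) =
      expect (A.select z.1 z.2) fun i => expect (recycle p z.1 i) f := by
  have hf : IsBdd fun w : Config n m × σ => f w.1 := (IsBdd.of_finite f).comp Prod.fst
  rw [step, expect_bind _ _ hf]
  congr 1
  ext i
  rw [expect_bind _ _ hf]
  congr 1
  ext Y
  rw [expect_map _ _ hf]
  exact expect_const _ (f Y)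

/-- With `D = 2m+n-1`, the factor `n/D` turns reward plus drift into `2k - (n+1)k²/D`, whose maximum
over `k` is `D/(n+1)`. -/
theorem quadratic_drift [NeZero n] [NeZero m] (A : Strategy n m σ) (z : Config n m × σ) :
    A.reward z + expect (A.step (PMF.uniformOfFintype (Fin n)) z)
        (fun w => n / (2 * m + n - 1) * ∑ j, (w.1.load j : ℝ) ^ 2) ≤
      (2 * m + n - 1) / (n + 1) + n / (2 * m + n - 1) * ∑ j, (z.1.load j : ℝ) ^ 2 := by
  have hn : (1 : ℝ) ≤ n := Nat.one_le_cast.2 NeZero.one_le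
  have hm : (1 : ℝ) ≤ m := Nat.one_le_cast.2 NeZero.one_le
  have hn0 : (n : ℝ) ≠ 0 := by linarith
  have hD : (0 : ℝ) < 2 * m + n - 1 := by linarith
  have hE : (0 : ℝ) < n + 1 := by linarith
  rw [expect_mul_left, A.expect_step _ _ fun X => ∑ j, (X.load j : ℝ) ^ 2, reward_eq_expect,
    ← expect_mul_left, ← expect_add _ (IsBdd.of_finite _) (IsBdd.of_finite _)]
  rw [← expect_const (A.select z.1 z.2) ((2 * m + n - 1) / (n + 1) +
    n / (2 * m + n - 1) * ∑ j, (z.1.load j : ℝ) ^ 2)]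
  refine expect_mono _ (IsBdd.of_finite _) (IsBdd.const _) fun i => ?_
  rw [expect_recycle_sum_sq, mul_add]
  generalize ∑ j, (z.1.load j : ℝ) ^ 2 = Q
  generalize (z.1.load i : ℝ) = k
  generalize hd : (2 * m + n - 1 : ℝ) = D at hD
  have h1 : (n : ℝ) / D * ((k * D - (n + 1) * k ^ 2) / n) = k - (n + 1) / D * k ^ 2 := by
    field_simp
  have h2 : 0 ≤ (n + 1) / D * (k - D / (n + 1)) ^ 2 := by positivity
  have h3 : (n + 1) / D * (k - D / (n + 1)) ^ 2
      = (n + 1) / D * k ^ 2 - 2 * k + D / (n + 1) := by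
    field_simp
    ring
  rw [h1]
  linarith

theorem isBdd_quadratic (c : ℝ) :
    IsBdd fun w : Config n m × σ => c * ∑ j, (w.1.load j : ℝ) ^ 2 :=
  (IsBdd.of_finite fun X : Config n m => c * ∑ j, (X.load j : ℝ) ^ 2).comp Prod.fst

theorem upperRate_le [NeZero n] [NeZero m] (A : Strategy n m σ) (μ₀ : PMF (Config n m × σ)) :
    A.upperRate (PMF.uniformOfFintype (Fin n)) μ₀ ≤ (2 * m + n - 1) / (n + 1) := by
  obtain ⟨D, hD⟩ := average_le_of_drift (μ := A.law (PMF.uniformOfFintype (Fin n)) μ₀)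
    (fun _ => rfl) A.isBdd_reward (isBdd_quadratic _) A.quadratic_drift
  have hlim := tendsto_const_add_div ((2 * m + n - 1) / (n + 1) : ℝ) D
  rw [← hlim.limsup_eq]
  refine Filter.limsup_le_limsup ?_ ?_ hlim.isBoundedUnder_le
  · filter_upwards [Filter.eventually_gt_atTop 0] with T hT using hD T hT
  -- A real `limsup` is monotone only under boundedness side conditions; here the averages are
  -- nonnegative.
  · refine Filter.IsBoundedUnder.isCoboundedUnder_le ⟨0, ?_⟩
    refine Filter.eventually_map.2 (Filter.Eventually.of_forall fun T => ?_)
    refine div_nonneg (Finset.sum_nonneg fun t _ => ?_) (Nat.cast_nonneg T)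
    refine tsum_nonneg fun z => mul_nonneg ENNReal.toReal_nonneg ?_
    exact Finset.sum_nonneg fun i _ => mul_nonneg ENNReal.toReal_nonneg (Nat.cast_nonneg _)

theorem expectedReward_le_of_isStationary [NeZero n] [NeZero m] (A : Strategy n m σ)
    {π : PMF (Config n m × σ)} (hπ : A.IsStationary (PMF.uniformOfFintype (Fin n)) π) :
    A.expectedReward π ≤ (2 * m + n - 1) / (n + 1) :=
  expect_le_of_drift_of_stationary hπ A.isBdd_reward (isBdd_quadratic _) A.quadratic_drift

theorem IsFullestBin.le_expectedReward [NeZero n] {A : Strategy n m Unit} (hA : A.IsFullestBin)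
    {π : PMF (Config n m × Unit)} (hπ : A.IsStationary (PMF.uniformOfFintype (Fin n)) π) :
    2 * (m : ℝ) / (n + 1) ≤ A.expectedReward π := by
  have hE : (0 : ℝ) < n + 1 := by positivity
  refine le_expect_of_drift_of_stationary hπ (G := fun w => (-(1 / (n + 1 : ℝ))) *
    ∑ a, ∑ b, min (w.1.load a : ℝ) (w.1.load b)) A.isBdd_reward (IsBdd.of_finite _) ?_
  rintro ⟨X, ⟨⟩⟩
  have h1 : expect (A.select X ()) (fun i => expect (recycle (PMF.uniformOfFintype (Fin n)) X i)
      fun X' => ∑ a, ∑ b, min (X'.load a : ℝ) (X'.load b)) ≤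
      ∑ a, ∑ b, min (X.load a : ℝ) (X.load b) + ((n + 1) * A.reward (X, ()) - 2 * m) := by
    have h2 : ∑ a, ∑ b, min (X.load a : ℝ) (X.load b) + ((n + 1) * A.reward (X, ()) - 2 * m) =
        expect (A.select X ()) fun i => (n + 1) * (X.load i : ℝ) +
          (∑ a, ∑ b, min (X.load a : ℝ) (X.load b) - 2 * m) := by
      rw [expect_add _ (IsBdd.of_finite _) (IsBdd.const _), expect_const, expect_mul_left,
        reward_eq_expect]
      ring
    rw [h2]
    -- The drift estimate needs a fullest bin, so it is available only on the support of the
    -- selection.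
    refine expect_mono_of_support _ (IsBdd.of_finite _) (IsBdd.of_finite _) fun i hi => ?_
    linarith [expect_recycle_sum_min_le X i (hA X i hi)]
  rw [expect_mul_left, A.expect_step _ _ fun X => ∑ a, ∑ b, min (X.load a : ℝ) (X.load b)]
  dsimp only at h1 ⊢
  have h3 := mul_le_mul_of_nonneg_left h1 (one_div_pos.2 hE).le
  have h4 : 1 / (n + 1 : ℝ) * (∑ a, ∑ b, min (X.load a : ℝ) (X.load b) +
      ((n + 1) * A.reward (X, ()) - 2 * m)) =
      1 / (n + 1 : ℝ) * (∑ a, ∑ b, min (X.load a : ℝ) (X.load b)) + A.reward (X, ())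
        - 2 * m / (n + 1) := by
    field_simp
    ring
  rw [h4] at h3
  linarith

end Strategy

/-! ### Golden Gate: the clockwise distance potential -/

section GoldenGate

variable {n m : ℕ}

/-- The number of bins that a clockwise walk from bin `b` meets before it reaches bin `i`. -/
def gap [NeZero n] (b i : Fin n) : ℕ := (i - (b + Fin.ofNat n 1)).val

theorem eq_add_gap [NeZero n] (b i : Fin n) : b + Fin.ofNat n (gap b i + 1) = i := by
  have h1 : Fin.ofNat n (gap b i + 1) = (i - (b + Fin.ofNat n 1)) + Fin.ofNat n 1 := by
    ext; simp [gap, Fin.val_add]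
  rw [h1, add_comm (i - _), ← add_assoc, add_sub_cancel]

theorem gap_add [NeZero n] (b : Fin n) {k : ℕ} (hk : k < n) :
    gap b (b + Fin.ofNat n (k + 1)) = k := by
  have h1 : b + Fin.ofNat n (k + 1) - (b + Fin.ofNat n 1) = Fin.ofNat n k := by
    have : Fin.ofNat n (k + 1) = Fin.ofNat n k + Fin.ofNat n 1 := by
      ext; simp [Fin.val_add]
    rw [this]
    abel
  rw [gap, h1, Fin.val_ofNat, Nat.mod_eq_of_lt hk]

/-- All bins skipped on the way to `X.next b` are empty, so a non-empty bin `i` lies strictly beyond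
it and the walk to `i` only gets shorter. -/
theorem gap_next_lt [NeZero n] [NeZero m] (X : Config n m) (b i : Fin n)
    (hi : X.load i ≠ 0) (hne : i ≠ X.next b) : gap (X.next b) i + 1 ≤ gap b i := by
  classical
  have hs : Nat.find (X.exists_next b) ≤ gap b i :=
    Nat.find_min' _ (by rwa [eq_add_gap])
  set s := Nat.find (X.exists_next b) with hsdef
  have hnext : X.next b = b + Fin.ofNat n (s + 1) := by
    rw [Config.next, hsdef]
  have hlt : s < gap b i := by
    refine lt_of_le_of_ne hs fun h => hne ?_
    rw [hnext, h, eq_add_gap]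
  have hi' : i = X.next b + Fin.ofNat n ((gap b i - s - 1) + 1) := by
    have h1 : Fin.ofNat n (s + 1) + Fin.ofNat n ((gap b i - s - 1) + 1)
        = Fin.ofNat n (gap b i + 1) := by
      rw [show gap b i + 1 = (s + 1) + ((gap b i - s - 1) + 1) by omega]
      ext; simp [Fin.val_add]
    rw [hnext, add_assoc, h1, eq_add_gap]
  have hn : gap b i < n := Fin.is_lt _
  have h2 := gap_add (X.next b) (k := gap b i - s - 1) (by omega)
  rw [← hi'] at h2
  omega

/-- As `i` varies, the gaps run once through `0, …, n-1`. -/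
theorem sum_gap [NeZero n] (b : Fin n) : ∑ i, (gap b i : ℝ) = n * (n - 1) / 2 := by
  have h1 : ∑ i, (gap b i : ℝ) = ∑ i : Fin n, (i.val : ℝ) :=
    Fintype.sum_equiv (Equiv.subRight (b + Fin.ofNat n 1)) _ _ fun _ => rfl
  rw [h1, Fin.sum_univ_eq_sum_range fun i => (i : ℝ)]
  have h2 := Finset.sum_range_id_mul_two n
  have h3 : ((∑ i ∈ Finset.range n, i : ℕ) : ℝ) * 2 = n * (n - 1) := by
    rw [← Nat.cast_pred (NeZero.pos n)]
    exact_mod_cast h2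
  push_cast at h3
  linarith

theorem goldenGate_reward [NeZero n] [NeZero m] (z : Config n m × Fin n) :
    (goldenGate n m).reward z = z.1.load (z.1.next z.2) := by
  rw [Strategy.reward_eq_expect]
  exact expect_pure _ _

theorem expect_goldenGate_step [NeZero n] [NeZero m] (p : PMF (Fin n)) (z : Config n m × Fin n)
    (f : Config n m × Fin n → ℝ) :
    expect ((goldenGate n m).step p z) f =
      expect (recycle p z.1 (z.1.next z.2)) fun Y => f (Y, z.1.next z.2) := by
  have h : (goldenGate n m).step p z =
      (recycle p z.1 (z.1.next z.2)).map fun Y => (Y, z.1.next z.2) := by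
    simp only [Strategy.step, goldenGate, PMF.pure_bind, PMF.pure_map]
    rfl
  rw [h, expect_map _ _ (IsBdd.of_finite f)]

theorem le_expectedReward_goldenGate [NeZero n] [NeZero m] {π : PMF (Config n m × Fin n)}
    (hπ : (goldenGate n m).IsStationary (PMF.uniformOfFintype (Fin n)) π) :
    2 * (m : ℝ) / (n + 1) ≤ (goldenGate n m).expectedReward π := by
  have hE : (0 : ℝ) < n + 1 := by positivity
  have hn : (n : ℝ) ≠ 0 := NeZero.ne _
  refine le_expect_of_drift_of_stationary hπ (G := fun w => (-(2 / (n + 1 : ℝ))) *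
    ∑ i, (gap w.2 i : ℝ) * w.1.load i) (goldenGate n m).isBdd_reward (IsBdd.of_finite _) ?_
  rintro ⟨X, b⟩
  rw [goldenGate_reward, expect_mul_left, expect_goldenGate_step,
    expect_finset_sum _ _ fun _ => IsBdd.of_finite _]
  simp only [expect_mul_left, expect_recycle_load, mul_add, Finset.sum_add_distrib,
    ← Finset.sum_mul, sum_gap]
  set l := X.next b with hl
  have h1 : ∑ i, (gap l i : ℝ) * X.remaining l i ≤
      ∑ i, (gap b i : ℝ) * X.load i - (m - X.load l) := by
    rw [← X.sum_remaining l, ← Finset.sum_sub_distrib]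
    refine Finset.sum_le_sum fun i _ => ?_
    rw [Config.remaining]
    split_ifs with hi
    · simp only [mul_zero, sub_zero]
      positivity
    -- The gap of a skipped empty bin may grow, but it carries no weight.
    · rcases eq_or_ne (X.load i) 0 with h0 | h0
      · simp [h0]
      · have h2 : (gap l i : ℝ) + 1 ≤ gap b i := by
          exact_mod_cast gap_next_lt X b i h0 hi
        nlinarith [(X.load i).cast_nonneg (α := ℝ)]
  have h3 := mul_le_mul_of_nonneg_left h1 (show (0 : ℝ) ≤ 2 / (n + 1) by positivity)
  have h4 : 2 / (n + 1 : ℝ) * (n * (n - 1) / 2 * (X.load l / n)) =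
      X.load l - 2 / (n + 1 : ℝ) * X.load l := by
    field_simp
    ring
  have h5 : 2 * (m : ℝ) / (n + 1) = 2 / (n + 1) * m := by ring
  rw [h5]
  linarith

end GoldenGate

/-! ### Existence of the recycling rate -/

section Rate

variable {n m : ℕ}

/-- All the balls are in bin `j`. -/
def Config.allIn (m : ℕ) (j : Fin n) : Config n m := ⟨Pi.single j m, by simp⟩

theorem allIn_mem_support_throwBalls [NeZero n] (k : ℕ) (j : Fin n) :
    Config.allIn k j ∈ (throwBalls (PMF.uniformOfFintype (Fin n)) k).support := by
  induction k with
  | zero =>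
    simp only [throwBalls, PMF.support_pure, Set.mem_singleton_iff]
    ext
    simp [Config.allIn]
  | succ k ih =>
    rw [throwBalls, PMF.mem_support_bind_iff]
    refine ⟨_, ih, ?_⟩
    rw [PMF.mem_support_map_iff]
    refine ⟨j, by simp, ?_⟩
    ext i
    simp [Config.allIn, Config.addBall, Pi.single_apply]
    split_ifs <;> rfl

namespace Strategy

variable {σ : Type*}

/-- The state `w` can follow the state `z` in the game with the uniform distribution. -/
def CanStep [NeZero n] (A : Strategy n m σ) (z w : Config n m × σ) : Prop :=
  w ∈ (A.step (PMF.uniformOfFintype (Fin n)) z).support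

theorem canStep_refill_allIn [NeZero n] (A : Strategy n m σ) {X : Config n m} {s s' : σ}
    {i : Fin n} (j : Fin n) (hi : i ∈ (A.select X s).support)
    (hs : s' ∈ (A.update s X i (X.refill i (Config.allIn _ j))).support) :
    A.CanStep (X, s) (X.refill i (Config.allIn _ j), s') := by
  rw [CanStep, step, PMF.mem_support_bind_iff]
  refine ⟨i, hi, ?_⟩
  rw [PMF.mem_support_bind_iff]
  refine ⟨X.refill i (Config.allIn _ j), ?_, ?_⟩
  · rw [recycle, PMF.mem_support_map_iff]
    exact ⟨_, allIn_mem_support_throwBalls _ j, rfl⟩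
  · rw [PMF.mem_support_map_iff]
    exact ⟨s', hs, rfl⟩

/-- Whichever bin is picked, with positive probability all its balls land in one other non-empty
bin, which lowers the number of non-empty bins. -/
theorem exists_reaches_allIn [NeZero n] (A : Strategy n m σ) (N : ℕ) (X : Config n m) (s : σ)
    (hN : (Finset.univ.filter fun i => X.load i ≠ 0).card ≤ N) :
    ∃ j s', Relation.ReflTransGen A.CanStep (X, s) (Config.allIn m j, s') := by
  induction N generalizing X s with
  | zero =>
    obtain ⟨i, hi⟩ := (A.select X s).support_nonempty
    have h := A.select_nonempty X s i hi
    rw [Nat.le_zero, Finset.card_eq_zero] at hN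
    exact absurd (Finset.mem_filter.2 ⟨Finset.mem_univ i, h⟩) (by rw [hN]; simp)
  | succ N ih =>
    obtain ⟨i, hi⟩ := (A.select X s).support_nonempty
    have h0 := A.select_nonempty X s i hi
    by_cases hj : ∃ j, j ≠ i ∧ X.load j ≠ 0
    · obtain ⟨j, hji, hj⟩ := hj
      obtain ⟨s', hs'⟩ :=
        (A.update s X i (X.refill i (Config.allIn _ j))).support_nonempty
      have hcard : (Finset.univ.filter fun a =>
          (X.refill i (Config.allIn _ j)).load a ≠ 0).card ≤ N := by
        refine Nat.le_of_lt_succ ((Finset.card_lt_card ?_).trans_le hN)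
        refine (Finset.ssubset_iff_of_subset ?_).2 ⟨i, by simpa using h0, ?_⟩
        · intro a
          simp only [Finset.mem_filter, Finset.mem_univ, true_and]
          intro ha h
          apply ha
          have haj : a ≠ j := fun h' => hj (h' ▸ h)
          have hai : a ≠ i := fun h' => h0 (h' ▸ h)
          simp only [Config.load] at h
          simp [Config.load, Config.refill, Config.allIn, haj, hai, h]
        · simp [Config.load, Config.refill, Config.allIn, hji.symm]
      obtain ⟨j', s'', h⟩ := ih _ s' hcard
      exact ⟨j', s'', h.head (A.canStep_refill_allIn j hi hs')⟩
    · push Not at hj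
      have hX : X = Config.allIn m i := by
        have hm : X.load i = m := by
          have h2 : ∑ a, X.load a = m := X.2
          rw [Finset.sum_eq_single i (fun b _ hb => hj b hb) (by simp)] at h2
          exact h2
        ext a
        rcases eq_or_ne a i with rfl | ha
        · simpa [Config.allIn, Config.load] using hm
        · simpa [Config.allIn, Config.load, ha] using hj a ha
      exact ⟨i, s, hX ▸ .refl⟩

theorem mem_support_select_allIn (A : Strategy n m σ) (j : Fin n) (s : σ) :
    j ∈ (A.select (Config.allIn m j) s).support := by
  obtain ⟨i, hi⟩ := (A.select (Config.allIn m j) s).support_nonempty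
  have h := A.select_nonempty _ s i hi
  have : i = j := by
    by_contra hij
    exact h (by simp [Config.load, Config.allIn, hij])
  exact this ▸ hi

theorem refill_allIn (i j : Fin n) :
    (Config.allIn m i).refill i (Config.allIn _ j) = Config.allIn m j := by
  ext a
  simp only [Config.refill, Config.allIn, Config.load, Pi.add_apply, Pi.single_apply,
    Function.update_apply]
  split_ifs <;> simp_all

/-- Once all balls share a bin, one round moves them to bin 0; a further round rethrows them into
bin 0 and sets the internal state to `s₀`. -/
theorem reaches_allIn_zero [NeZero n] (A : Strategy n m σ) {s₀ : σ}
    (hs₀ : ∀ s, s₀ ∈ (A.update s (Config.allIn m 0) 0 (Config.allIn m 0)).support)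
    (z : Config n m × σ) : Relation.ReflTransGen A.CanStep z (Config.allIn m 0, s₀) := by
  obtain ⟨j, s, h⟩ := A.exists_reaches_allIn _ z.1 z.2 le_rfl
  obtain ⟨s', hs'⟩ := (A.update s (Config.allIn m j) j
    ((Config.allIn m j).refill j (Config.allIn _ 0))).support_nonempty
  have h1 := A.canStep_refill_allIn 0 (A.mem_support_select_allIn j s) hs'
  have h2 := A.canStep_refill_allIn (s' := s₀) 0 (A.mem_support_select_allIn 0 s')
    (by rw [refill_allIn]; exact hs₀ s')
  rw [refill_allIn] at h1 h2
  exact (h.tail h1).tail h2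

theorem exists_hasRecyclingRate [NeZero n] [Finite σ] (A : Strategy n m σ) {s₀ : σ}
    (hs₀ : ∀ s, s₀ ∈ (A.update s (Config.allIn m 0) 0 (Config.allIn m 0)).support) :
    ∃ r, A.HasRecyclingRate (PMF.uniformOfFintype (Fin n)) r := by
  cases nonempty_fintype (Config n m × σ)
  have hz := A.reaches_allIn_zero hs₀
  obtain ⟨r, g, h⟩ := exists_poisson hz A.reward
  refine ⟨r, fun μ₀ => ?_, ?_, fun π hπ => le_antisymm ?_ ?_⟩
  · exact tendsto_average_of_poisson (μ := A.law _ μ₀) (fun _ => rfl) A.isBdd_reward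
      (IsBdd.of_finite g) h
  · exact exists_stationary hz
      (μ := A.law _ (PMF.pure (Config.allIn m 0, s₀))) fun _ => rfl
  · exact expect_le_of_drift_of_stationary hπ A.isBdd_reward (IsBdd.of_finite g)
      fun z => (h z).le
  · exact le_expect_of_drift_of_stationary hπ A.isBdd_reward (IsBdd.of_finite g)
      fun z => (h z).ge

end Strategy

end Rate

theorem upper_bound_le_add_one (n m : ℕ) :
    (2 * (m : ℝ) + n - 1) / (n + 1) ≤ 2 * (m : ℝ) / (n + 1) + 1 := by
  have hE : (0 : ℝ) < n + 1 := by positivity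
  rw [div_add_one hE.ne', div_le_div_iff_of_pos_right hE]
  linarith

end BallRecycling

end

open BallRecycling in
theorem theorem2 :
    ∃ C : ℝ, ∀ (n m : ℕ) [NeZero n] [NeZero m],
      -- Fullest Bin: rate at least `2m/(n+1)`, optimal up to the additive constant `C`
      (∀ FB : Strategy n m Unit, FB.IsFullestBin →
        ∃ r : ℝ, FB.HasRecyclingRate (PMF.uniformOfFintype (Fin n)) r ∧
          2 * (m : ℝ) / ((n : ℝ) + 1) ≤ r ∧
          ∀ (σ : Type u) (A : Strategy n m σ) (μ₀ : PMF (Config n m × σ)),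
            A.upperRate (PMF.uniformOfFintype (Fin n)) μ₀ ≤ r + C) ∧
      -- Golden Gate: the same
      (∃ r : ℝ, (goldenGate n m).HasRecyclingRate (PMF.uniformOfFintype (Fin n)) r ∧
          2 * (m : ℝ) / ((n : ℝ) + 1) ≤ r ∧
          ∀ (σ : Type u) (A : Strategy n m σ) (μ₀ : PMF (Config n m × σ)),
            A.upperRate (PMF.uniformOfFintype (Fin n)) μ₀ ≤ r + C) ∧
      -- no strategy has a larger rate than `(2m+n-1)/n`, in the long run or in stationarity
      (∀ (σ : Type u) (A : Strategy n m σ),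
        (∀ μ₀ : PMF (Config n m × σ), A.upperRate (PMF.uniformOfFintype (Fin n)) μ₀ ≤
          (2 * (m : ℝ) + (n : ℝ) - 1) / (n : ℝ)) ∧
        (∀ π : PMF (Config n m × σ), A.IsStationary (PMF.uniformOfFintype (Fin n)) π →
          A.expectedReward π ≤ (2 * (m : ℝ) + (n : ℝ) - 1) / (n : ℝ))) ∧
      (2 * (m : ℝ) + (n : ℝ) - 1) / (n : ℝ) < 2 * (m : ℝ) / (n : ℝ) + 1 := by
  -- The two bounds differ by `(n-1)/(n+1) < 1`.
  refine ⟨1, fun n m _ _ => ?_⟩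
  have hn : (1 : ℝ) ≤ n := Nat.one_le_cast.2 NeZero.one_le
  have hm : (1 : ℝ) ≤ m := Nat.one_le_cast.2 NeZero.one_le
  have hn0 : (0 : ℝ) < n := by linarith
  -- The drift bound has the sharper denominator `n + 1`; the stated one is a weakening, too coarse
  -- for an absolute `C`.
  have hc : (2 * (m : ℝ) + n - 1) / (n + 1) ≤ (2 * m + n - 1) / n :=
    div_le_div_of_nonneg_left (by linarith) hn0 (by linarith)
  refine ⟨fun FB hFB => ?_, ?_, fun σ A => ⟨fun μ₀ => (A.upperRate_le μ₀).trans hc,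
    fun π hπ => (A.expectedReward_le_of_isStationary hπ).trans hc⟩, ?_⟩
  · obtain ⟨r, hr⟩ := FB.exists_hasRecyclingRate (s₀ := ()) fun s =>
      (PMF.support_nonempty _).elim fun _ h => h
    obtain ⟨π, hπ⟩ := hr.2.1
    have hle := hr.2.2 π hπ ▸ hFB.le_expectedReward hπ
    refine ⟨r, hr, hle, fun σ A μ₀ => ?_⟩
    linarith [A.upperRate_le μ₀, upper_bound_le_add_one n m]
  -- After bin 0 is recycled, the remembered bin is 0.
  · obtain ⟨r, hr⟩ := (goldenGate n m).exists_hasRecyclingRate (s₀ := 0) fun s => by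
      simp [goldenGate]
    obtain ⟨π, hπ⟩ := hr.2.1
    have hle := hr.2.2 π hπ ▸ le_expectedReward_goldenGate hπ
    refine ⟨r, hr, hle, fun σ A μ₀ => ?_⟩
    linarith [A.upperRate_le μ₀, upper_bound_le_add_one n m]
  · rw [div_add_one hn0.ne', div_lt_div_iff_of_pos_right hn0]
    linarith
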